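/- Let $d$ be a dimension. For a finite nonempty set $A\subseteq\mathbb R^d$ write $\delta_A=\frac1{\#A}\sum_{a\in A}\delta_a$. An *admissible pair* in $\mathbb R^d$ is a pair $(R,B)$, where $R\in M_d(\mathbb Z)$ has all its eigenvalues of modulus strictly greater than $1$ and $B\subseteq\mathbb Z^d$ is a finite nonempty set, such that for some finite $L\subseteq\mathbb Z^d$ with $\#L=\#B$ the matrix $\big[\tfrac1{\sqrt{\#B}}e^{-2\pi i (R^{-1}b)\cdot\ell}\big]_{b\in B,\ \ell\in L}$ is unitary. Let $\{(R_n,B_n)\}_{n=1}^\infty$ be a sequence of admissible pairs in $\mathbb R^d$. Suppose that (i) $\lim_{n\to\infty}\|R_1^{-1}R_2^{-1}\cdots R_n^{-1}\|=0$ (operator norm for the Euclidean norm), and that there is a cube $C=t_0+[0,1]^d$, $t_0\in\mathbb R^d$, such that (ii) $R_n^{-1}(C+b)\subseteq C$ for every $n\ge1$ and every $b\in B_n$; (iii) there is an admissible pair $(R,B)$ with $(R_n,B_n)=(R,B)$ for infinitely many $n$, and $R^{-1}(C+b_0)\subseteq\operatorname{int}(C)$ for some $b_0\in B$. Then the infinite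 convolution $$\mu=\delta_{R_1^{-1}B_1}*\delta_{(R_2R_1)^{-1}B_2}*\cdots*\delta_{(R_n\cdots R_2R_1)^{-1}B_n}*\cdots$$ exists, i.e. the finite convolutions $\mu_n=\delta_{R_1^{-1}B_1}*\cdots*\delta_{(R_n\cdots R_1)^{-1}B_n}$ converge weakly to a Borel probability measure $\mu$ on $\mathbb R^d$, and $\mu$ is a spectral measure with a spectrum in $\mathbb Z^d$: there is a (countable) set $\Lambda\subseteq\mathbb Z^d$ such that the family $\{e^{2\pi i\lambda\cdot x}\}_{\lambda\in\Lambda}$ is an orthonormal basis of $L^2(\mu)$. -/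

import Mathlib

open MeasureTheory Filter Topology

noncomputable section

namespace SpectralConv

/-- `ℝ^d` with its Euclidean norm and standard inner product. -/
abbrev E (d : ℕ) : Type := EuclideanSpace ℝ (Fin d)

/-- An integral vector, seen in `ℝ^d`. -/
def intVec {d : ℕ} (b : Fin d → ℤ) : E d := WithLp.toLp 2 (fun i => (b i : ℝ))

/-- An integral matrix, seen as a real matrix. -/
def realMat {d : ℕ} (R : Matrix (Fin d) (Fin d) ℤ) : Matrix (Fin d) (Fin d) ℝ :=
  R.map (Int.cast : ℤ → ℝ)

/-- The linear map `x ↦ M x` of `ℝ^d`; its norm is the operator norm `‖M‖` of `M` with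
respect to the Euclidean norm. -/
def toMap {d : ℕ} (M : Matrix (Fin d) (Fin d) ℝ) : E d →L[ℝ] E d :=
  Matrix.toEuclideanCLM (𝕜 := ℝ) M

/-- All (complex) eigenvalues have modulus strictly greater than `1`. -/
def IsExpanding {d : ℕ} (R : Matrix (Fin d) (Fin d) ℤ) : Prop :=
  ∀ z ∈ spectrum ℂ (R.map (Int.cast : ℤ → ℂ)), 1 < ‖z‖

/-- The matrix `[ (#B)^{-1/2} exp(-2πi (R⁻¹ b)·ℓ) ]` with rows `b ∈ B` and columns `ℓ ∈ L`. -/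
def hadamardMatrix {d : ℕ} (R : Matrix (Fin d) (Fin d) ℤ) (B L : Finset (Fin d → ℤ)) :
    Matrix B L ℂ :=
  fun b l => (1 / (Real.sqrt (B.card : ℝ) : ℂ)) *
    Complex.exp (-2 * Real.pi * Complex.I *
      (inner ℝ (toMap (realMat R)⁻¹ (intVec b.1)) (intVec l.1) : ℝ))

/-- `(R, B)` is an admissible pair: `R` is an expanding integral matrix, `B` is a (nonempty) finite
set of integral vectors, and for some finite `L ⊆ ℤ^d` with `#L = #B` the matrix above is
unitary. -/
structure IsAdmissiblePair {d : ℕ} (R : Matrix (Fin d) (Fin d) ℤ) (B : Finset (Fin d → ℤ)) :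
    Prop where
  expanding : IsExpanding R
  nonempty : B.Nonempty
  hadamard : ∃ L : Finset (Fin d → ℤ), L.card = B.card ∧
    hadamardMatrix R B L * (hadamardMatrix R B L).conjTranspose = 1 ∧
    (hadamardMatrix R B L).conjTranspose * hadamardMatrix R B L = 1

open Classical in
/-- The finite set `M⁻¹ B ⊆ ℝ^d`. -/
def invImage {d : ℕ} (M : Matrix (Fin d) (Fin d) ℝ) (B : Finset (Fin d → ℤ)) : Finset (E d) :=
  B.image (fun b => toMap M⁻¹ (intVec b))

/-- The discrete measure `δ_A = (1 / #A) ∑_{a ∈ A} δ_a`. -/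
def discreteMeasure {d : ℕ} (A : Finset (E d)) : Measure (E d) :=
  (A.card : ENNReal)⁻¹ • ∑ a ∈ A, Measure.dirac a

/-- The product `R_n ⋯ R_2 R_1`. Sequences are indexed from `0`, so that the `n`-th matrix `R_n` of
the mathematical text is `R (n - 1)` here. -/
def cumProd {d : ℕ} (R : ℕ → Matrix (Fin d) (Fin d) ℤ) : ℕ → Matrix (Fin d) (Fin d) ℝ
  | 0 => 1
  | n + 1 => realMat (R n) * cumProd R n

/-- The product `R_1⁻¹ R_2⁻¹ ⋯ R_n⁻¹`. -/
def invProd {d : ℕ} (R : ℕ → Matrix (Fin d) (Fin d) ℤ) : ℕ → Matrix (Fin d) (Fin d) ℝ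
  | 0 => 1
  | n + 1 => invProd R n * (realMat (R n))⁻¹

/-- The finite convolution
`μ_n = δ_{R_1⁻¹ B_1} ∗ δ_{(R_2 R_1)⁻¹ B_2} ∗ ⋯ ∗ δ_{(R_n ⋯ R_1)⁻¹ B_n}`, with `μ_0 = δ_0`. -/
def finiteConv {d : ℕ} (R : ℕ → Matrix (Fin d) (Fin d) ℤ) (B : ℕ → Finset (Fin d → ℤ)) :
    ℕ → Measure (E d)
  | 0 => Measure.dirac 0
  | n + 1 =>
    Measure.conv (finiteConv R B n) (discreteMeasure (invImage (cumProd R (n + 1)) (B n)))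

/-- Weak convergence, tested on bounded continuous functions. -/
def WeaklyConverges {d : ℕ} (μs : ℕ → Measure (E d)) (μ : Measure (E d)) : Prop :=
  ∀ f : BoundedContinuousFunction (E d) ℝ,
    Tendsto (fun n => ∫ x, f x ∂(μs n)) atTop (𝓝 (∫ x, f x ∂μ))

/-- The Borel probability measure `μ` is the infinite convolution of the sequence `(R_n, B_n)`,
that is, the weak limit of the finite convolutions `μ_n`. -/
def IsInfiniteConvolution {d : ℕ} (R : ℕ → Matrix (Fin d) (Fin d) ℤ)
    (B : ℕ → Finset (Fin d → ℤ)) (μ : Measure (E d)) : Prop :=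
  IsProbabilityMeasure μ ∧ WeaklyConverges (finiteConv R B) μ

/-- `Λ` is a spectrum of `μ`: it is countable and the family `e_λ(x) = exp(2πi λ·x)`, `λ ∈ Λ`, is
an orthonormal (Hilbert) basis of `L²(μ)`. -/
def IsSpectrum {d : ℕ} (μ : Measure (E d)) (Λ : Set (E d)) : Prop :=
  Λ.Countable ∧ ∃ e : HilbertBasis Λ ℂ (Lp ℂ 2 μ), ∀ l : Λ,
    (e l : E d → ℂ) =ᵐ[μ] fun x =>
      Complex.exp (2 * Real.pi * Complex.I * (inner ℝ (l : E d) x : ℝ))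

/-- The cube `t + [0,1]^d`. -/
def unitCube {d : ℕ} (t : E d) : Set (E d) := {x | ∀ i, t i ≤ x i ∧ x i ≤ t i + 1}

end SpectralConv

end

open SpectralConv

noncomputable section

namespace SpectralConv

variable {d : ℕ}

lemma toMap_mul (M N : Matrix (Fin d) (Fin d) ℝ) (x : E d) :
    toMap (M * N) x = toMap M (toMap N x) := by
  simp [toMap]

lemma toMap_one (x : E d) : toMap (1 : Matrix (Fin d) (Fin d) ℝ) x = x := by
  simp [toMap]

lemma toMap_transpose (M : Matrix (Fin d) (Fin d) ℝ) :
    toMap M.transpose = ContinuousLinearMap.adjoint (toMap M) := by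
  have h := map_star (Matrix.toEuclideanCLM (n := Fin d) (𝕜 := ℝ)) M
  rwa [ContinuousLinearMap.star_eq_adjoint, Matrix.star_eq_conjTranspose,
    Matrix.conjTranspose_eq_transpose_of_trivial] at h

lemma norm_toMap_transpose (M : Matrix (Fin d) (Fin d) ℝ) : ‖toMap M.transpose‖ = ‖toMap M‖ := by
  rw [toMap_transpose, LinearIsometryEquiv.norm_map]

lemma inner_toMap (M : Matrix (Fin d) (Fin d) ℝ) (x y : E d) :
    inner ℝ (toMap M x) y = inner ℝ x (toMap M.transpose y) := by
  rw [toMap_transpose, ContinuousLinearMap.adjoint_inner_right]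

lemma realMat_transpose_intVec (M : Matrix (Fin d) (Fin d) ℤ) (k : Fin d → ℤ) :
    toMap (realMat M).transpose (intVec k) = intVec (M.transpose.mulVec k) := by
  ext i
  simp [toMap, intVec, realMat, Matrix.mulVec, dotProduct]

lemma intVec_add (k l : Fin d → ℤ) : intVec (k + l) = intVec k + intVec l := by
  ext i; simp [intVec]

lemma intVec_neg (k : Fin d → ℤ) : intVec (-k) = -intVec k := by
  ext i; simp [intVec]

lemma intVec_zero : intVec (0 : Fin d → ℤ) = 0 := by
  ext i; simp [intVec]

lemma intVec_injective : Function.Injective (intVec : (Fin d → ℤ) → E d) := by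
  intro a b h
  ext i
  have := congrArg (fun v : E d => v i) h
  simpa [intVec] using this

lemma inner_intVec (k l : Fin d → ℤ) : inner ℝ (intVec k) (intVec l) = ((k ⬝ᵥ l : ℤ) : ℝ) := by
  simp [intVec, PiLp.inner_apply, dotProduct, mul_comm]

lemma IsExpanding.isUnit_det {R : Matrix (Fin d) (Fin d) ℤ} (h : IsExpanding R) :
    IsUnit (realMat R).det := by
  have h0 : (0 : ℂ) ∉ spectrum ℂ (R.map (Int.cast : ℤ → ℂ)) := fun h0 => by
    have := h 0 h0
    simp at this
    linarith
  rw [spectrum.zero_notMem_iff, Matrix.isUnit_iff_isUnit_det] at h0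
  have e1 : (R.map (Int.cast : ℤ → ℂ)).det = ((R.det : ℤ) : ℂ) :=
    ((Int.castRingHom ℂ).map_det R).symm
  have e2 : (realMat R).det = ((R.det : ℤ) : ℝ) := ((Int.castRingHom ℝ).map_det R).symm
  rw [e1, isUnit_iff_ne_zero] at h0
  rw [e2, isUnit_iff_ne_zero]
  exact_mod_cast h0

lemma isUnit_det_cumProd {R : ℕ → Matrix (Fin d) (Fin d) ℤ}
    (hR : ∀ n, IsUnit (realMat (R n)).det) (n : ℕ) : IsUnit (cumProd R n).det := by
  induction n with
  | zero => simp [cumProd]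
  | succ n ih => rw [cumProd, Matrix.det_mul]; exact (hR n).mul ih

lemma invProd_eq (R : ℕ → Matrix (Fin d) (Fin d) ℤ) (n : ℕ) : invProd R n = (cumProd R n)⁻¹ := by
  induction n with
  | zero => simp [invProd, cumProd]
  | succ n ih => rw [invProd, cumProd, Matrix.mul_inv_rev, ih]

lemma cumProd_shift (R : ℕ → Matrix (Fin d) (Fin d) ℤ) (n m : ℕ) :
    cumProd R (n + m) = cumProd (fun k => R (n + k)) m * cumProd R n := by
  induction m with
  | zero => simp [cumProd]
  | succ m ih => rw [← add_assoc, cumProd, cumProd, ih, Matrix.mul_assoc]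

/-- The map `ξ ↦ (R_n ⋯ R_1)^{-T} ξ`. -/
def dualMap (R : ℕ → Matrix (Fin d) (Fin d) ℤ) (n : ℕ) : E d →L[ℝ] E d :=
  toMap ((cumProd R n)⁻¹).transpose

lemma dualMap_succ (R : ℕ → Matrix (Fin d) (Fin d) ℤ) (n : ℕ) (x : E d) :
    dualMap R (n + 1) x = toMap ((realMat (R n))⁻¹).transpose (dualMap R n x) := by
  rw [dualMap, dualMap, cumProd, Matrix.mul_inv_rev, Matrix.transpose_mul, toMap_mul]

lemma dualMap_shift (R : ℕ → Matrix (Fin d) (Fin d) ℤ) (n m : ℕ) (x : E d) :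
    dualMap R (n + m) x = dualMap (fun k => R (n + k)) m (dualMap R n x) := by
  rw [dualMap, dualMap, dualMap, cumProd_shift, Matrix.mul_inv_rev, Matrix.transpose_mul, toMap_mul]

lemma toMap_inv_apply {M : Matrix (Fin d) (Fin d) ℝ} (hM : IsUnit M.det) (x : E d) :
    toMap M⁻¹ (toMap M x) = x := by
  rw [← toMap_mul, Matrix.nonsing_inv_mul _ hM, toMap_one]

lemma toMap_apply_inv {M : Matrix (Fin d) (Fin d) ℝ} (hM : IsUnit M.det) (x : E d) :
    toMap M (toMap M⁻¹ x) = x := by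
  rw [← toMap_mul, Matrix.mul_nonsing_inv _ hM, toMap_one]

lemma dualMap_transpose {R : ℕ → Matrix (Fin d) (Fin d) ℤ}
    (hR : ∀ n, IsUnit (realMat (R n)).det) (n : ℕ) (x : E d) :
    dualMap R n (toMap (cumProd R n).transpose x) = x := by
  rw [dualMap, Matrix.transpose_nonsing_inv, toMap_inv_apply]
  rw [Matrix.det_transpose]
  exact isUnit_det_cumProd hR n

lemma tendsto_dualMap {R : ℕ → Matrix (Fin d) (Fin d) ℤ}
    (hlim : Tendsto (fun n => ‖toMap (invProd R n)‖) atTop (𝓝 0)) (x : E d) :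
    Tendsto (fun n => dualMap R n x) atTop (𝓝 0) := by
  have h : Tendsto (fun n => ‖toMap (invProd R n)‖ * ‖x‖) atTop (𝓝 0) := by
    simpa using hlim.mul_const ‖x‖
  refine squeeze_zero_norm (fun n => ?_) h
  rw [invProd_eq, ← norm_toMap_transpose]
  exact (dualMap R n).le_opNorm x

/-- The lattice `ℤ^d` in `ℝ^d`. -/
def latt (d : ℕ) : AddSubgroup (E d) where
  carrier := Set.range intVec
  add_mem' := by
    rintro _ _ ⟨a, rfl⟩ ⟨b, rfl⟩
    exact ⟨a + b, intVec_add a b⟩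
  zero_mem' := ⟨0, intVec_zero⟩
  neg_mem' := by
    rintro _ ⟨a, rfl⟩
    exact ⟨-a, intVec_neg a⟩

lemma intVec_mem_latt (k : Fin d → ℤ) : intVec k ∈ latt d := ⟨k, rfl⟩

lemma realMat_transpose_mem_latt (M : Matrix (Fin d) (Fin d) ℤ) {x : E d} (hx : x ∈ latt d) :
    toMap (realMat M).transpose x ∈ latt d := by
  obtain ⟨k, rfl⟩ := hx
  rw [realMat_transpose_intVec]
  exact intVec_mem_latt _

lemma cumProd_succ_transpose (R : ℕ → Matrix (Fin d) (Fin d) ℤ) (n : ℕ) (x : E d) :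
    toMap (cumProd R (n + 1)).transpose x =
      toMap (cumProd R n).transpose (toMap (realMat (R n)).transpose x) := by
  rw [cumProd, Matrix.transpose_mul, toMap_mul]

lemma cumProd_transpose_mem_latt (R : ℕ → Matrix (Fin d) (Fin d) ℤ) (n : ℕ) {x : E d}
    (hx : x ∈ latt d) : toMap (cumProd R n).transpose x ∈ latt d := by
  induction n generalizing x with
  | zero => simpa [cumProd, toMap_one] using hx
  | succ n ih =>
    rw [cumProd_succ_transpose]
    exact ih (realMat_transpose_mem_latt _ hx)

/-- The character `x ↦ exp (2πi ξ·x)`. -/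
def expo (ξ x : E d) : ℂ := Complex.exp (2 * Real.pi * Complex.I * (inner ℝ ξ x : ℝ))

lemma expo_add_left (ξ η x : E d) : expo (ξ + η) x = expo ξ x * expo η x := by
  rw [expo, expo, expo, ← Complex.exp_add, inner_add_left]
  push_cast; ring_nf

lemma expo_comm (ξ x : E d) : expo ξ x = expo x ξ := by
  rw [expo, expo, real_inner_comm]

lemma expo_add_right (ξ x y : E d) : expo ξ (x + y) = expo ξ x * expo ξ y := by
  rw [expo_comm, expo_add_left, expo_comm x, expo_comm y]

lemma norm_expo (ξ x : E d) : ‖expo ξ x‖ = 1 := by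
  rw [expo, show (2 * Real.pi * Complex.I * (inner ℝ ξ x : ℝ) : ℂ) =
    ((2 * Real.pi * inner ℝ ξ x : ℝ) : ℂ) * Complex.I by push_cast; ring,
    Complex.norm_exp_ofReal_mul_I]

lemma expo_neg_left (ξ x : E d) : expo (-ξ) x = starRingEnd ℂ (expo ξ x) := by
  rw [expo, expo, ← Complex.exp_conj]
  simp [Complex.conj_ofNat]

lemma expo_zero_left (x : E d) : expo 0 x = 1 := by simp [expo]

lemma expo_toMap (M : Matrix (Fin d) (Fin d) ℝ) (ξ x : E d) :
    expo (toMap M ξ) x = expo ξ (toMap M.transpose x) := by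
  rw [expo, expo, inner_toMap]

lemma continuous_expo (ξ : E d) : Continuous (expo ξ) := by
  unfold expo; fun_prop

lemma expo_latt {k l : E d} (hk : k ∈ latt d) (hl : l ∈ latt d) : expo k l = 1 := by
  obtain ⟨k, rfl⟩ := hk
  obtain ⟨l, rfl⟩ := hl
  rw [expo, inner_intVec]
  rw [Complex.exp_eq_one_iff]
  exact ⟨k ⬝ᵥ l, by push_cast; ring⟩

/-- The mask polynomial `(1 / #B) ∑_{b ∈ B} exp (2πi b·ξ)`. -/
def mask (B : Finset (Fin d → ℤ)) (ξ : E d) : ℂ :=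
  (B.card : ℂ)⁻¹ * ∑ b ∈ B, expo (intVec b) ξ

lemma mask_add_latt (B : Finset (Fin d → ℤ)) (ξ : E d) {k : E d} (hk : k ∈ latt d) :
    mask B (ξ + k) = mask B ξ := by
  simp [mask, expo_add_right, expo_latt (intVec_mem_latt _) hk]

lemma mask_zero {B : Finset (Fin d → ℤ)} (hB : B.Nonempty) : mask B 0 = 1 := by
  have : (B.card : ℂ) ≠ 0 := by exact_mod_cast hB.card_pos.ne'
  simp [mask, expo, this]

lemma sum_norm_mask_sq_of_hadamard {R : Matrix (Fin d) (Fin d) ℤ} {B L : Finset (Fin d → ℤ)}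
    (hB : B.Nonempty) (h : hadamardMatrix R B L * (hadamardMatrix R B L).conjTranspose = 1)
    (η : E d) :
    ∑ l ∈ L, ‖mask B (toMap ((realMat R)⁻¹).transpose (η + intVec l))‖ ^ 2 = 1 := by
  set H := hadamardMatrix R B L with hH
  set v : B → ℂ := fun b => expo (intVec b.1) (toMap ((realMat R)⁻¹).transpose η) with hv
  have hc : (0 : ℝ) < B.card := by exact_mod_cast hB.card_pos
  have hs : (Real.sqrt (B.card : ℝ) : ℂ) ≠ 0 := by
    exact_mod_cast (Real.sqrt_pos.2 hc).ne'
  have hss : (Real.sqrt (B.card : ℝ) : ℂ) * (Real.sqrt (B.card : ℝ) : ℂ) = B.card := by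
    rw [← Complex.ofReal_mul, Real.mul_self_sqrt hc.le]; simp
  have hm : ∀ l : L, mask B (toMap ((realMat R)⁻¹).transpose (η + intVec l.1)) =
      (Real.sqrt (B.card : ℝ) : ℂ)⁻¹ * (H.conjTranspose.mulVec v) l := by
    intro l
    rw [mask, ← Finset.sum_coe_sort B, Matrix.mulVec, dotProduct, Finset.mul_sum, Finset.mul_sum]
    refine Finset.sum_congr rfl fun b _ => ?_
    rw [map_add, expo_add_right, Matrix.conjTranspose_apply, hH, hadamardMatrix, hv]
    rw [← expo_toMap (realMat R)⁻¹ (intVec b.1) (intVec l.1)]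
    have : star (1 / (Real.sqrt (B.card : ℝ) : ℂ) * Complex.exp (-2 * Real.pi * Complex.I *
      (inner ℝ (toMap (realMat R)⁻¹ (intVec b.1)) (intVec l.1) : ℝ))) =
      (Real.sqrt (B.card : ℝ) : ℂ)⁻¹ * expo (toMap (realMat R)⁻¹ (intVec b.1)) (intVec l.1) := by
      rw [star_mul', expo]
      congr 1
      · simp
      · simp only [Complex.star_def]
        rw [← Complex.exp_conj]
        simp [Complex.conj_ofNat]
    rw [this, ← hss]
    field_simp
  have hnorm : ∑ l : L, ‖(H.conjTranspose.mulVec v) l‖ ^ 2 = B.card := by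
    have h1 : star (H.conjTranspose.mulVec v) ⬝ᵥ (H.conjTranspose.mulVec v) = star v ⬝ᵥ v := by
      rw [Matrix.star_mulVec, Matrix.conjTranspose_conjTranspose, Matrix.dotProduct_mulVec,
        Matrix.vecMul_vecMul, h, Matrix.vecMul_one]
    have h2 : ∀ {ι : Type} [Fintype ι] (w : ι → ℂ), star w ⬝ᵥ w = ((∑ i, ‖w i‖ ^ 2 : ℝ) : ℂ) := by
      intro ι _ w
      simp [dotProduct, Complex.conj_mul']
    rw [h2, h2] at h1
    have h3 := Complex.ofReal_injective h1
    rw [h3]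
    simp [hv, norm_expo]
  rw [← Finset.sum_coe_sort L]
  simp_rw [hm, norm_mul, mul_pow]
  rw [← Finset.mul_sum, hnorm, norm_inv, Complex.norm_real, Real.norm_eq_abs, inv_pow, sq_abs,
    Real.sq_sqrt hc.le, inv_mul_cancel₀ hc.ne']

/-- A set of frequencies for an admissible pair, normalised to contain `0`. -/
lemma IsAdmissiblePair.exists_frequencies {R : Matrix (Fin d) (Fin d) ℤ} {B : Finset (Fin d → ℤ)}
    (h : IsAdmissiblePair R B) : ∃ L : Finset (Fin d → ℤ), 0 ∈ L ∧ ∀ η : E d,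
      ∑ l ∈ L, ‖mask B (toMap ((realMat R)⁻¹).transpose (η + intVec l))‖ ^ 2 = 1 := by
  classical
  obtain ⟨L, hc, hL, -⟩ := h.hadamard
  have hne : L.Nonempty := by
    rw [← Finset.card_pos, hc]; exact h.nonempty.card_pos
  obtain ⟨l₀, hl₀⟩ := hne
  refine ⟨L.image (fun l => l - l₀), Finset.mem_image.2 ⟨l₀, hl₀, sub_self _⟩, fun η => ?_⟩
  rw [Finset.sum_image (fun _ _ _ _ h => sub_left_injective h)]
  rw [← sum_norm_mask_sq_of_hadamard h.nonempty hL (η - intVec l₀)]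
  refine Finset.sum_congr rfl fun l _ => ?_
  have : η + intVec (l - l₀) = η - intVec l₀ + intVec l := by
    rw [sub_eq_add_neg l, intVec_add, intVec_neg]
    abel
  rw [← this]

/-- The Fourier transform `ξ ↦ ∫ exp (2πi ξ·x) dμ(x)`. -/
def fhat (μ : Measure (E d)) (ξ : E d) : ℂ := ∫ x, expo ξ x ∂μ

lemma fhat_eq_charFun (μ : Measure (E d)) (ξ : E d) :
    fhat μ ξ = charFun μ ((2 * Real.pi) • ξ) := by
  rw [fhat, charFun_apply]
  congr 1
  ext x
  rw [expo, inner_smul_right, real_inner_comm]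
  push_cast; ring_nf

lemma fhat_conv (μ ν : Measure (E d)) [IsFiniteMeasure μ] [IsFiniteMeasure ν] (ξ : E d) :
    fhat (Measure.conv μ ν) ξ = fhat μ ξ * fhat ν ξ := by
  simp only [fhat_eq_charFun, charFun_conv]

lemma integrable_expo (μ : Measure (E d)) [IsFiniteMeasure μ] (ξ : E d) :
    Integrable (expo ξ) μ :=
  Integrable.of_bound (continuous_expo ξ).aestronglyMeasurable 1
    (Eventually.of_forall fun x => (norm_expo ξ x).le)

lemma fhat_zero (μ : Measure (E d)) [IsProbabilityMeasure μ] : fhat μ 0 = 1 := by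
  simp [fhat, expo_zero_left]

lemma isProbabilityMeasure_discreteMeasure {A : Finset (E d)} (hA : A.Nonempty) :
    IsProbabilityMeasure (discreteMeasure A) := by
  constructor
  have : (A.card : ENNReal) ≠ 0 := by exact_mod_cast hA.card_pos.ne'
  simp [discreteMeasure, ENNReal.inv_mul_cancel this]

lemma invImage_nonempty (M : Matrix (Fin d) (Fin d) ℝ) {B : Finset (Fin d → ℤ)}
    (hB : B.Nonempty) : (invImage M B).Nonempty := by
  classical
  simpa [invImage] using hB

lemma injective_toMap_inv {M : Matrix (Fin d) (Fin d) ℝ} (hM : IsUnit M.det) :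
    Function.Injective fun b : Fin d → ℤ => toMap M⁻¹ (intVec b) := by
  intro a b h
  have := congrArg (toMap M) h
  simp only [toMap_apply_inv hM] at this
  exact intVec_injective this

lemma card_invImage {M : Matrix (Fin d) (Fin d) ℝ} (hM : IsUnit M.det)
    (B : Finset (Fin d → ℤ)) : (invImage M B).card = B.card := by
  classical
  exact Finset.card_image_of_injective _ (injective_toMap_inv hM)

lemma fhat_discreteMeasure {M : Matrix (Fin d) (Fin d) ℝ} (hM : IsUnit M.det)
    (B : Finset (Fin d → ℤ)) (ξ : E d) :
    fhat (discreteMeasure (invImage M B)) ξ = mask B (toMap M⁻¹.transpose ξ) := by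
  classical
  rw [fhat, discreteMeasure, integral_smul_measure, integral_finsetSum_measure, card_invImage hM,
    mask]
  · simp only [integral_dirac, invImage]
    rw [Finset.sum_image fun _ _ _ _ h => injective_toMap_inv hM h]
    simp only [ENNReal.toReal_inv, ENNReal.toReal_natCast, Complex.real_smul]
    push_cast
    congr 1
    refine Finset.sum_congr rfl fun b _ => ?_
    rw [expo_comm, expo_toMap]
  · intro a _
    exact integrable_expo _ _

/-- The Fourier transform of the `n`-th finite convolution. -/
def prodMask (R : ℕ → Matrix (Fin d) (Fin d) ℤ) (B : ℕ → Finset (Fin d → ℤ)) :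
    ℕ → E d → ℂ
  | 0, _ => 1
  | n + 1, ξ => prodMask R B n ξ * mask (B n) (dualMap R (n + 1) ξ)

section

variable {R : ℕ → Matrix (Fin d) (Fin d) ℤ} {B : ℕ → Finset (Fin d → ℤ)}

lemma isProbabilityMeasure_finiteConv (hB : ∀ n, (B n).Nonempty) (n : ℕ) :
    IsProbabilityMeasure (finiteConv R B n) := by
  induction n with
  | zero => rw [finiteConv]; infer_instance
  | succ n ih =>
    rw [finiteConv]
    have := isProbabilityMeasure_discreteMeasure
      (invImage_nonempty (cumProd R (n + 1)) (hB n))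
    infer_instance

lemma fhat_finiteConv (hR : ∀ n, IsUnit (realMat (R n)).det) (hB : ∀ n, (B n).Nonempty)
    (n : ℕ) (ξ : E d) : fhat (finiteConv R B n) ξ = prodMask R B n ξ := by
  induction n with
  | zero => simp [fhat, finiteConv, prodMask, expo]
  | succ n ih =>
    have := isProbabilityMeasure_finiteConv (R := R) hB n
    have := isProbabilityMeasure_discreteMeasure
      (invImage_nonempty (cumProd R (n + 1)) (hB n))
    rw [finiteConv, fhat_conv, ih, fhat_discreteMeasure (isUnit_det_cumProd hR _), prodMask,
      dualMap]

lemma prodMask_zero (hB : ∀ n, (B n).Nonempty) (n : ℕ) : prodMask R B n 0 = 1 := by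
  induction n with
  | zero => rfl
  | succ n ih => rw [prodMask, ih, map_zero, mask_zero (hB n), one_mul]

lemma prodMask_add (n m : ℕ) (ξ : E d) :
    prodMask R B (n + m) ξ =
      prodMask R B n ξ * prodMask (fun k => R (n + k)) (fun k => B (n + k)) m (dualMap R n ξ) := by
  induction m with
  | zero => simp [prodMask]
  | succ m ih =>
    rw [← add_assoc, prodMask, prodMask, ih, add_assoc, dualMap_shift, mul_assoc]

lemma prodMask_add_latt (hR : ∀ n, IsUnit (realMat (R n)).det) (n : ℕ) (ξ : E d) {k : E d}
    (hk : k ∈ latt d) :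
    prodMask R B n (ξ + toMap (cumProd R n).transpose k) = prodMask R B n ξ := by
  induction n generalizing k with
  | zero => rfl
  | succ n ih =>
    rw [prodMask, map_add, dualMap_transpose hR, mask_add_latt _ _ hk, cumProd_succ_transpose,
      ih (realMat_transpose_mem_latt _ hk), prodMask]

variable (R B) in
/-- The finite set `Λ` is a spectrum of the `n`-th finite convolution. -/
def UnitSum (n : ℕ) (Λ : Finset (E d)) : Prop :=
  (Λ : Set (E d)) ⊆ latt d ∧ ∀ ξ, ∑ l ∈ Λ, ‖prodMask R B n (ξ + l)‖ ^ 2 = 1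

open Classical in
lemma UnitSum.of_family (hB : ∀ n, (B n).Nonempty) {n : ℕ} {ι : Type*} (s : Finset ι)
    (g : ι → E d) (hg : ∀ i ∈ s, g i ∈ latt d)
    (h : ∀ ξ, ∑ i ∈ s, ‖prodMask R B n (ξ + g i)‖ ^ 2 = 1) : UnitSum R B n (s.image g) := by
  refine ⟨fun x hx => ?_, fun ξ => ?_⟩
  · obtain ⟨i, hi, rfl⟩ := Finset.mem_image.1 (Finset.mem_coe.1 hx)
    exact hg i hi
  rw [Finset.sum_image, h]
  intro i hi j hj hij
  by_contra hne
  have h2 := h (-g i)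
  have : ∑ k ∈ ({i, j} : Finset ι), ‖prodMask R B n (-g i + g k)‖ ^ 2 ≤ 1 := by
    rw [← h2]
    refine Finset.sum_le_sum_of_subset_of_nonneg ?_ fun _ _ _ => by positivity
    simp only [Finset.mem_coe] at hi hj
    intro k hk
    rcases Finset.mem_insert.1 hk with rfl | hk
    · exact hi
    · rw [Finset.mem_singleton.1 hk]; exact hj
  rw [Finset.sum_pair hne, ← hij, neg_add_cancel, prodMask_zero hB] at this
  norm_num at this

lemma unitSum_zero : UnitSum R B 0 {0} := by
  refine ⟨?_, fun ξ => ?_⟩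
  · simp [(latt d).zero_mem]
  · simp [prodMask]

lemma UnitSum.exists_succ (hadm : ∀ n, IsAdmissiblePair (R n) (B n)) {n : ℕ} {Λ : Finset (E d)}
    (h : UnitSum R B n Λ) : ∃ Λ' : Finset (E d), Λ ⊆ Λ' ∧ UnitSum R B (n + 1) Λ' := by
  classical
  have hR : ∀ n, IsUnit (realMat (R n)).det := fun n => (hadm n).expanding.isUnit_det
  obtain ⟨L, h0, hL⟩ := (hadm n).exists_frequencies
  refine ⟨_, ?_, UnitSum.of_family (fun n => (hadm n).nonempty) (Λ ×ˢ L)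
    (fun p => p.1 + toMap (cumProd R n).transpose (intVec p.2)) ?_ ?_⟩
  · intro l hl
    refine Finset.mem_image.2 ⟨(l, 0), Finset.mem_product.2 ⟨hl, h0⟩, ?_⟩
    simp [intVec_zero]
  · intro p hp
    exact (latt d).add_mem (h.1 (Finset.mem_product.1 hp).1)
      (cumProd_transpose_mem_latt R n (intVec_mem_latt _))
  · intro ξ
    rw [Finset.sum_product, ← h.2 ξ]
    refine Finset.sum_congr rfl fun l _ => ?_
    have : ∀ m ∈ L, ‖prodMask R B (n + 1)
        (ξ + (l + toMap (cumProd R n).transpose (intVec m)))‖ ^ 2 =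
        ‖prodMask R B n (ξ + l)‖ ^ 2 * ‖mask (B n) (toMap ((realMat (R n))⁻¹).transpose
          (dualMap R n (ξ + l) + intVec m))‖ ^ 2 := by
      intro m _
      rw [prodMask, ← add_assoc, prodMask_add_latt hR n _ (intVec_mem_latt m), dualMap_succ,
        map_add (dualMap R n), dualMap_transpose hR, norm_mul, mul_pow]
    rw [Finset.sum_congr rfl this, ← Finset.mul_sum, hL, mul_one]

lemma UnitSum.exists_of_le (hadm : ∀ n, IsAdmissiblePair (R n) (B n)) {n m : ℕ} (hnm : n ≤ m)
    {Λ : Finset (E d)} (h : UnitSum R B n Λ) :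
    ∃ Λ' : Finset (E d), Λ ⊆ Λ' ∧ UnitSum R B m Λ' := by
  induction m, hnm using Nat.le_induction with
  | base => exact ⟨Λ, subset_rfl, h⟩
  | succ m _ ih =>
    obtain ⟨Λ₁, h₁, h₁'⟩ := ih
    obtain ⟨Λ₂, h₂, h₂'⟩ := h₁'.exists_succ hadm
    exact ⟨Λ₂, h₁.trans h₂, h₂'⟩

/-- A spectrum of a finite convolution may be translated elementwise by the period lattice. -/
lemma UnitSum.translate (hadm : ∀ n, IsAdmissiblePair (R n) (B n)) {n : ℕ} {Λ : Finset (E d)}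
    (h : UnitSum R B n Λ) (k : E d → E d) (hk : ∀ l, k l ∈ latt d) :
    ∃ Λ' : Finset (E d), UnitSum R B n Λ' ∧
      ∀ x, x ∈ Λ' ↔ ∃ l ∈ Λ, l + toMap (cumProd R n).transpose (k l) = x := by
  classical
  have hR : ∀ n, IsUnit (realMat (R n)).det := fun n => (hadm n).expanding.isUnit_det
  refine ⟨_, UnitSum.of_family (fun n => (hadm n).nonempty) Λ
    (fun l => l + toMap (cumProd R n).transpose (k l)) ?_ ?_, fun x => Finset.mem_image⟩
  · exact fun l hl => (latt d).add_mem (h.1 hl) (cumProd_transpose_mem_latt R n (hk l))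
  · intro ξ
    rw [← h.2 ξ]
    refine Finset.sum_congr rfl fun l _ => ?_
    rw [← add_assoc, prodMask_add_latt hR n _ (hk l)]

lemma UnitSum.prodMask_eq_zero (hB : ∀ n, (B n).Nonempty) {n : ℕ} {Λ : Finset (E d)}
    (h : UnitSum R B n Λ) {l m : E d} (hl : l ∈ Λ) (hm : m ∈ Λ) (hne : l ≠ m) :
    prodMask R B n (m - l) = 0 := by
  classical
  have h1 := h.2 (-l)
  have h2 : ∑ k ∈ ({l, m} : Finset (E d)), ‖prodMask R B n (-l + k)‖ ^ 2 ≤ 1 := by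
    rw [← h1]
    refine Finset.sum_le_sum_of_subset_of_nonneg ?_ fun _ _ _ => by positivity
    intro k hk
    rcases Finset.mem_insert.1 hk with rfl | hk
    · exact hl
    · rw [Finset.mem_singleton.1 hk]; exact hm
  rw [Finset.sum_pair hne, neg_add_cancel, prodMask_zero hB, neg_add_eq_sub] at h2
  have h3 : ‖prodMask R B n (m - l)‖ ^ 2 ≤ 0 := by
    norm_num at h2 ⊢
    exact h2
  have h4 : ‖prodMask R B n (m - l)‖ = 0 := by
    have := le_antisymm h3 (by positivity)
    simpa using this
  simpa using h4

end

lemma unitCube_eq_preimage (t : E d) :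
    unitCube t = (EuclideanSpace.equiv (Fin d) ℝ).toHomeomorph ⁻¹'
      (Set.univ.pi fun i => Set.Icc (t i) (t i + 1)) := by
  ext x
  simp [unitCube, -Set.pi_univ_Icc, Set.mem_pi]

lemma isCompact_unitCube (t : E d) : IsCompact (unitCube t) := by
  rw [unitCube_eq_preimage, Homeomorph.isCompact_preimage]
  exact isCompact_univ_pi fun i => isCompact_Icc

lemma mem_interior_unitCube {t x : E d} (hx : x ∈ interior (unitCube t)) (i : Fin d) :
    t i < x i ∧ x i < t i + 1 := by
  rw [unitCube_eq_preimage, ← Homeomorph.preimage_interior,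
    interior_pi_set (Set.toFinite _)] at hx
  simp only [interior_Icc, Set.mem_preimage] at hx
  exact hx i (Set.mem_univ i)

lemma mem_unitCube_self (t : E d) : t ∈ unitCube t := fun i => ⟨le_rfl, by linarith⟩

/-- A bump function, positive exactly in the interior of the cube among its points. -/
def bump (t x : E d) : ℝ := ∏ i, (x i - t i) * (t i + 1 - x i)

lemma continuous_bump (t : E d) : Continuous (bump t) := by
  unfold bump; fun_prop

lemma bump_nonneg {t x : E d} (hx : x ∈ unitCube t) : 0 ≤ bump t x :=
  Finset.prod_nonneg fun i _ => mul_nonneg (by linarith [(hx i).1]) (by linarith [(hx i).2])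

lemma bump_pos {t x : E d} (hx : x ∈ interior (unitCube t)) : 0 < bump t x :=
  Finset.prod_pos fun i _ => mul_pos (by linarith [(mem_interior_unitCube hx i).1])
    (by linarith [(mem_interior_unitCube hx i).2])

lemma expo_eq_prod (ξ x : E d) :
    expo ξ x = ∏ i, Complex.exp (2 * Real.pi * Complex.I * (ξ i * x i)) := by
  rw [expo, ← Complex.exp_sum, PiLp.inner_apply, ← Finset.mul_sum]
  congr 2
  push_cast
  refine Finset.sum_congr rfl fun i _ => ?_
  simp [mul_comm]

/-- The projection `ℝ^d → (ℝ/ℤ)^d`. -/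
def toTorus (x : E d) : UnitAddTorus (Fin d) := fun i => (x i : UnitAddCircle)

lemma mFourier_toTorus (k : Fin d → ℤ) (x : E d) :
    UnitAddTorus.mFourier k (toTorus x) = expo (intVec k) x := by
  rw [expo_eq_prod]
  simp only [UnitAddTorus.mFourier, ContinuousMap.coe_mk, toTorus]
  refine Finset.prod_congr rfl fun i _ => ?_
  rw [fourier_coe_apply]
  congr 1
  simp [intVec]
  ring

/-- One coordinate of the bump function times a character, on `[s, s + 1]`. -/
def twistedBump (s a : ℝ) (u : ℝ) : ℂ :=
  ((u - s) * (s + 1 - u) : ℝ) * Complex.exp (2 * Real.pi * Complex.I * (a * u))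

lemma continuous_liftIco_twistedBump (s a : ℝ) :
    Continuous (AddCircle.liftIco (1 : ℝ) s (twistedBump s a)) := by
  refine AddCircle.liftIco_continuous (by simp [twistedBump]) ?_
  unfold twistedBump
  fun_prop

lemma liftIco_twistedBump (s a : ℝ) {u : ℝ} (hu : s ≤ u ∧ u ≤ s + 1) :
    AddCircle.liftIco (1 : ℝ) s (twistedBump s a) (u : UnitAddCircle) = twistedBump s a u := by
  rcases hu.2.eq_or_lt with rfl | h
  · have : ((s + 1 : ℝ) : UnitAddCircle) = (s : UnitAddCircle) := by
      rw [AddCircle.coe_add, AddCircle.coe_period, add_zero]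
    rw [this, AddCircle.liftIco_coe_apply (by constructor <;> linarith)]
    simp [twistedBump]
  · exact AddCircle.liftIco_coe_apply ⟨hu.1, h⟩

/-- The bump function times a character is uniformly close on the cube to a trigonometric
polynomial with integral frequencies. -/
lemma exists_trigPolynomial_near (t ξ : E d) {η : ℝ} (hη : 0 < η) :
    ∃ c : (Fin d → ℤ) →₀ ℂ, ∀ x ∈ unitCube t,
      ‖∑ k ∈ c.support, c k * expo (intVec k) x - bump t x * expo ξ x‖ ≤ η := by
  let G : C(UnitAddTorus (Fin d), ℂ) :=
    ⟨fun y => ∏ i, AddCircle.liftIco (1 : ℝ) (t i) (twistedBump (t i) (ξ i)) (y i),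
      continuous_finsetProd _ fun i _ =>
        (continuous_liftIco_twistedBump (t i) (ξ i)).comp (continuous_apply i)⟩
  have hG : G ∈ (Submodule.span ℂ
      (Set.range <| UnitAddTorus.mFourier (d := Fin d))).topologicalClosure := by
    rw [UnitAddTorus.span_mFourier_closure_eq_top]; trivial
  rw [← SetLike.mem_coe, Submodule.topologicalClosure_coe, Metric.mem_closure_iff] at hG
  obtain ⟨p, hp, hpG⟩ := hG η hη
  obtain ⟨c, rfl⟩ := Finsupp.mem_span_range_iff_exists_finsupp.1 hp
  refine ⟨c, fun x hx => ?_⟩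
  have h1 : ∑ k ∈ c.support, c k * expo (intVec k) x =
      (c.sum fun i a => a • UnitAddTorus.mFourier i) (toTorus x) := by
    simp [Finsupp.sum, mFourier_toTorus]
  have h2 : (bump t x : ℂ) * expo ξ x = G (toTorus x) := by
    simp only [G, ContinuousMap.coe_mk, toTorus]
    rw [Finset.prod_congr rfl fun i _ => liftIco_twistedBump (t i) (ξ i) (hx i), bump,
      expo_eq_prod]
    push_cast
    rw [← Finset.prod_mul_distrib]
    simp [twistedBump]
  rw [h1, h2, ← dist_eq_norm, dist_comm]
  exact (ContinuousMap.dist_apply_le_dist _).trans hpG.le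

lemma exists_latt_le_norm_fhat (t ξ : E d) {a : ℝ} (ha : 0 < a) :
    ∃ ε > 0, ∀ ν : Measure (E d), IsProbabilityMeasure ν → (∀ᵐ x ∂ν, x ∈ unitCube t) →
      a ≤ ∫ x, bump t x ∂ν → ∃ k ∈ latt d, ε ≤ ‖fhat ν (ξ + k)‖ := by
  obtain ⟨c, hc⟩ := exists_trigPolynomial_near t (-ξ) (half_pos ha)
  set S := ∑ k ∈ c.support, ‖c k‖ with hS
  have hS0 : 0 ≤ S := Finset.sum_nonneg fun _ _ => norm_nonneg _
  refine ⟨a / 2 / (S + 1), by positivity, fun ν _ hν hb => ?_⟩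
  by_contra! hcon
  have h1 : ∑ k ∈ c.support, c k * fhat ν (ξ + intVec k) =
      ∫ x, (∑ k ∈ c.support, c k * expo (intVec k) x) * expo ξ x ∂ν := by
    simp_rw [Finset.sum_mul]
    rw [integral_finsetSum]
    · refine Finset.sum_congr rfl fun k _ => ?_
      rw [fhat, ← integral_const_mul]
      refine integral_congr_ae (Eventually.of_forall fun x => ?_)
      simp only [expo_add_left]; ring
    · intro k _
      have := (integrable_expo ν (ξ + intVec k)).const_mul (c k)
      refine this.congr (Eventually.of_forall fun x => ?_)
      simp only [expo_add_left]; ring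
  have h2 : ‖∑ k ∈ c.support, c k * fhat ν (ξ + intVec k) - ((∫ x, bump t x ∂ν : ℝ) : ℂ)‖
      ≤ a / 2 := by
    obtain ⟨M, hM⟩ := (isCompact_unitCube t).exists_bound_of_continuousOn
      (continuous_bump t).continuousOn
    have hbi : Integrable (bump t) ν :=
      Integrable.of_bound (continuous_bump t).aestronglyMeasurable M (hν.mono hM)
    have hcont : Continuous fun x =>
        (∑ k ∈ c.support, c k * expo (intVec k) x) * expo ξ x := by
      have := fun k : Fin d → ℤ => continuous_expo (intVec k)
      have := continuous_expo ξ
      fun_prop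
    have hci : Integrable (fun x =>
        (∑ k ∈ c.support, c k * expo (intVec k) x) * expo ξ x) ν := by
      refine Integrable.of_bound hcont.aestronglyMeasurable S (Eventually.of_forall fun x => ?_)
      rw [norm_mul, norm_expo, mul_one]
      refine (norm_sum_le _ _).trans (Finset.sum_le_sum fun k _ => ?_)
      rw [norm_mul, norm_expo, mul_one]
    have hbc : Integrable (fun x => (bump t x : ℂ)) ν := hbi.ofReal
    have h3 : ((∫ x, bump t x ∂ν : ℝ) : ℂ) = ∫ x, (bump t x : ℂ) ∂ν := integral_ofReal.symm
    rw [h1, h3, ← integral_sub hci hbc]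
    have := norm_integral_le_of_norm_le_const (μ := ν) (C := a / 2)
      (f := fun x => (∑ k ∈ c.support, c k * expo (intVec k) x) * expo ξ x - bump t x)
      (hν.mono fun x hx => ?_)
    · simpa using this
    · have h4 : (bump t x : ℂ) = bump t x * expo (-ξ) x * expo ξ x := by
        rw [mul_assoc, ← expo_add_left, neg_add_cancel, expo_zero_left, mul_one]
      rw [h4, ← sub_mul, norm_mul, norm_expo, mul_one]
      exact hc x hx
  have h5 : ‖∑ k ∈ c.support, c k * fhat ν (ξ + intVec k)‖ ≤ S * (a / 2 / (S + 1)) := by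
    rw [hS, Finset.sum_mul]
    refine (norm_sum_le _ _).trans (Finset.sum_le_sum fun k _ => ?_)
    rw [norm_mul]
    exact mul_le_mul_of_nonneg_left (hcon _ (intVec_mem_latt k)).le (norm_nonneg _)
  have h6 : S * (a / 2 / (S + 1)) < a / 2 := by
    rw [mul_div_assoc', div_lt_iff₀ (by positivity)]
    nlinarith
  have h7 := norm_sub_norm_le ((∫ x, bump t x ∂ν : ℝ) : ℂ)
    (∑ k ∈ c.support, c k * fhat ν (ξ + intVec k))
  rw [norm_sub_rev, Complex.norm_real, Real.norm_eq_abs] at h7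
  have h8 := le_abs_self (∫ x, bump t x ∂ν)
  linarith

/-- Fourier transforms of probability measures on a cube are uniformly Lipschitz. -/
lemma exists_lipschitz_fhat (t : E d) :
    ∃ M > 0, ∀ ν : Measure (E d), IsProbabilityMeasure ν → (∀ᵐ x ∂ν, x ∈ unitCube t) →
      ∀ ξ η : E d, ‖fhat ν ξ - fhat ν η‖ ≤ M * ‖ξ - η‖ := by
  obtain ⟨M, hM⟩ := (isCompact_unitCube t).isBounded.exists_norm_le
  have hM0 : 0 ≤ M := (norm_nonneg t).trans (hM t (mem_unitCube_self t))
  refine ⟨2 * Real.pi * (M + 1), by positivity, fun ν _ hν ξ η => ?_⟩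
  rw [fhat, fhat, ← integral_sub (integrable_expo ν ξ) (integrable_expo ν η)]
  have := norm_integral_le_of_norm_le_const (μ := ν) (C := 2 * Real.pi * (M + 1) * ‖ξ - η‖)
      (f := fun x => expo ξ x - expo η x) (hν.mono fun x hx => ?_)
  · simpa using this
  have h1 : expo ξ x - expo η x = expo η x * (expo (ξ - η) x - 1) := by
    rw [mul_sub, ← expo_add_left, mul_one, add_sub_cancel]
  rw [h1, norm_mul, norm_expo, one_mul, expo,
    show (2 * Real.pi * Complex.I * (inner ℝ (ξ - η) x : ℝ) : ℂ) =
      Complex.I * ((2 * Real.pi * inner ℝ (ξ - η) x : ℝ) : ℂ) by push_cast; ring]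
  refine Real.norm_exp_I_mul_ofReal_sub_one_le.trans ?_
  rw [Real.norm_eq_abs, abs_mul, abs_of_pos Real.two_pi_pos, mul_assoc (2 * Real.pi)]
  refine mul_le_mul_of_nonneg_left ?_ Real.two_pi_pos.le
  refine (abs_real_inner_le_norm _ _).trans ?_
  rw [mul_comm]
  exact mul_le_mul_of_nonneg_right ((hM x hx).trans (by linarith)) (norm_nonneg _)

lemma exists_sub_mem_unitCube (x : E d) : ∃ k ∈ latt d, x - k ∈ unitCube (0 : E d) := by
  refine ⟨intVec fun i => ⌊x i⌋, intVec_mem_latt _, fun i => ?_⟩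
  simp only [intVec, PiLp.sub_apply, PiLp.zero_apply]
  constructor <;> linarith [Int.floor_le (x i), Int.lt_floor_add_one (x i)]

/-- The family of probability measures on the cube giving the compact subset `K` of its interior a
mass bounded below is equi-positive. -/
lemma exists_equiPositive (t : E d) {K : Set (E d)} (hK : IsCompact K)
    (hKt : K ⊆ interior (unitCube t)) {c : ℝ} (hc : 0 < c) :
    ∃ ε > 0, ∃ δ > 0, ∀ ν : Measure (E d), IsProbabilityMeasure ν →
      (∀ᵐ x ∂ν, x ∈ unitCube t) → c ≤ ν.real K → ∀ x : E d, ∃ k ∈ latt d, ∀ y : E d, ‖y‖ < δ →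
        ε ≤ ‖fhat ν (x + k + y)‖ := by
  obtain ⟨M, hM0, hM⟩ := exists_lipschitz_fhat t
  obtain ⟨m, hm0, hm⟩ : ∃ m > 0, ∀ x ∈ K, m ≤ bump t x := by
    rcases K.eq_empty_or_nonempty with rfl | hne
    · exact ⟨1, one_pos, by simp⟩
    · obtain ⟨x, hx, hmin⟩ := hK.exists_isMinOn hne (continuous_bump t).continuousOn
      exact ⟨bump t x, bump_pos (hKt hx), fun y hy => hmin hy⟩
  have hbump : ∀ ν : Measure (E d), IsProbabilityMeasure ν → (∀ᵐ x ∂ν, x ∈ unitCube t) →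
      c ≤ ν.real K → c * m ≤ ∫ x, bump t x ∂ν := by
    intro ν _ hν hcK
    obtain ⟨A, hA⟩ := (isCompact_unitCube t).exists_bound_of_continuousOn
      (continuous_bump t).continuousOn
    have hbi : Integrable (bump t) ν :=
      Integrable.of_bound (continuous_bump t).aestronglyMeasurable A (hν.mono hA)
    calc c * m ≤ ν.real K * m := by gcongr
      _ = ∫ x in K, m ∂ν := by simp
      _ ≤ ∫ x in K, bump t x ∂ν :=
        setIntegral_mono_on (integrable_const _).integrableOn hbi.integrableOn
          hK.measurableSet hm
      _ ≤ ∫ x, bump t x ∂ν :=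
        setIntegral_le_integral hbi (hν.mono fun x hx => bump_nonneg hx)
  have key : ∃ ε > 0, ∃ δ > 0, ∀ ν : Measure (E d), IsProbabilityMeasure ν →
      (∀ᵐ x ∂ν, x ∈ unitCube t) → c ≤ ν.real K → ∀ x ∈ unitCube (0 : E d), ∃ k ∈ latt d,
        ∀ y : E d, ‖y‖ < δ → ε ≤ ‖fhat ν (x + k + y)‖ := by
    refine (isCompact_unitCube (0 : E d)).induction_on
      (p := fun s => ∃ ε > 0, ∃ δ > 0, ∀ ν : Measure (E d), IsProbabilityMeasure ν →
      (∀ᵐ x ∂ν, x ∈ unitCube t) → c ≤ ν.real K → ∀ x ∈ s, ∃ k ∈ latt d,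
        ∀ y : E d, ‖y‖ < δ → ε ≤ ‖fhat ν (x + k + y)‖) ?_ ?_ ?_ ?_
    · exact ⟨1, one_pos, 1, one_pos, by simp⟩
    · rintro s s' hss ⟨ε, hε, δ, hδ, h⟩
      exact ⟨ε, hε, δ, hδ, fun ν h1 h2 h3 x hx => h ν h1 h2 h3 x (hss hx)⟩
    · rintro s s' ⟨ε, hε, δ, hδ, h⟩ ⟨ε', hε', δ', hδ', h'⟩
      refine ⟨min ε ε', lt_min hε hε', min δ δ', lt_min hδ hδ', fun ν h1 h2 h3 x hx => ?_⟩
      rcases hx with hx | hx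
      · obtain ⟨k, hk, hy⟩ := h ν h1 h2 h3 x hx
        exact ⟨k, hk, fun y hyd => (min_le_left _ _).trans (hy y (hyd.trans_le (min_le_left _ _)))⟩
      · obtain ⟨k, hk, hy⟩ := h' ν h1 h2 h3 x hx
        exact ⟨k, hk, fun y hyd =>
          (min_le_right _ _).trans (hy y (hyd.trans_le (min_le_right _ _)))⟩
    · intro ξ _
      obtain ⟨ε, hε, h⟩ := exists_latt_le_norm_fhat t ξ (mul_pos hc hm0)
      refine ⟨Metric.ball ξ (ε / (4 * M)),
        mem_nhdsWithin_of_mem_nhds (Metric.ball_mem_nhds _ (by positivity)),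
        ε / 2, half_pos hε, ε / (4 * M), by positivity, fun ν h1 h2 h3 x hx => ?_⟩
      obtain ⟨k, hk, hke⟩ := h ν h1 h2 (hbump ν h1 h2 h3)
      refine ⟨k, hk, fun y hy => ?_⟩
      have h4 := hM ν h1 h2 (ξ + k) (x + k + y)
      have h5 : ‖ξ + k - (x + k + y)‖ ≤ ε / (4 * M) + ε / (4 * M) := by
        rw [show ξ + k - (x + k + y) = (ξ - x) - y by abel]
        refine (norm_sub_le _ _).trans (add_le_add ?_ hy.le)
        rw [← dist_eq_norm, dist_comm]
        exact (Metric.mem_ball.1 hx).le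
      have h6 : M * ‖ξ + k - (x + k + y)‖ ≤ ε / 2 := by
        calc _ ≤ M * (ε / (4 * M) + ε / (4 * M)) := by gcongr
          _ = ε / 2 := by field_simp; ring
      have h7 := norm_sub_norm_le (fhat ν (ξ + k)) (fhat ν (x + k + y))
      linarith
  obtain ⟨ε, hε, δ, hδ, h⟩ := key
  refine ⟨ε, hε, δ, hδ, fun ν h1 h2 h3 x => ?_⟩
  obtain ⟨k₀, hk₀, hx⟩ := exists_sub_mem_unitCube x
  obtain ⟨k, hk, hy⟩ := h ν h1 h2 h3 _ hx
  refine ⟨k - k₀, (latt d).sub_mem hk hk₀, fun y hyd => ?_⟩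
  rw [show x + (k - k₀) + y = x - k₀ + k + y by abel]
  exact hy y hyd

/-- The Fourier transforms of probability measures on a cube are uniformly large near `0`. -/
lemma exists_half_le_norm_fhat (t : E d) :
    ∃ δ > 0, ∀ ν : Measure (E d), IsProbabilityMeasure ν → (∀ᵐ x ∂ν, x ∈ unitCube t) →
      ∀ y : E d, ‖y‖ < δ → 1 / 2 ≤ ‖fhat ν y‖ := by
  obtain ⟨M, hM0, hM⟩ := exists_lipschitz_fhat t
  refine ⟨1 / (2 * M), by positivity, fun ν h1 h2 y hy => ?_⟩
  have h3 := hM ν h1 h2 0 y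
  rw [fhat_zero, zero_sub, norm_neg] at h3
  have h4 : M * ‖y‖ ≤ 1 / 2 := by
    calc M * ‖y‖ ≤ M * (1 / (2 * M)) := by gcongr
      _ = 1 / 2 := by field_simp
  have h5 := norm_sub_norm_le 1 (fhat ν y)
  rw [norm_one] at h5
  linarith

lemma discreteMeasure_ae_mem (A : Finset (E d)) : ∀ᵐ x ∂(discreteMeasure A), x ∈ A := by
  have h : discreteMeasure A {x | x ∉ A} = 0 := by
    rw [discreteMeasure, Measure.smul_apply, Measure.finsetSum_apply]
    have : ∀ a ∈ A, Measure.dirac a {x | x ∉ A} = 0 := fun a ha => by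
      change Measure.dirac a (A : Set (E d))ᶜ = 0
      rw [Measure.dirac_apply' _ (A.measurableSet.compl)]
      simp [ha]
    rw [Finset.sum_eq_zero this, smul_zero]
  exact h

lemma discreteMeasure_singleton {A : Finset (E d)} {a : E d} (ha : a ∈ A) :
    discreteMeasure A {a} = (A.card : ENNReal)⁻¹ := by
  classical
  rw [discreteMeasure, Measure.smul_apply, Measure.finsetSum_apply]
  have : ∀ b ∈ A, Measure.dirac b {a} = if b = a then 1 else 0 := fun b _ => by
    rw [Measure.dirac_apply' _ (measurableSet_singleton a)]
    simp [Set.indicator_apply]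
  rw [Finset.sum_congr rfl this, Finset.sum_ite_eq' A a, if_pos ha, smul_eq_mul, mul_one]

section

variable {R : ℕ → Matrix (Fin d) (Fin d) ℤ} {B : ℕ → Finset (Fin d → ℤ)} {t : E d}

/-- The cylinder `∑_{k < n} ω_k + (R_n ⋯ R_1)⁻¹ C`. -/
def cyl (R : ℕ → Matrix (Fin d) (Fin d) ℤ) (t : E d) (ω : ℕ → E d) (n : ℕ) : Set (E d) :=
  (fun x => ∑ k ∈ Finset.range n, ω k + toMap (cumProd R n)⁻¹ x) '' unitCube t

lemma cyl_succ_subset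
    (hmaps : ∀ n, ∀ b ∈ B n,
      (fun x => toMap (realMat (R n))⁻¹ (x + intVec b)) '' unitCube t ⊆ unitCube t)
    {ω : ℕ → E d} (hω : ∀ n, ω n ∈ invImage (cumProd R (n + 1)) (B n)) (n : ℕ) :
    cyl R t ω (n + 1) ⊆ cyl R t ω n := by
  classical
  rintro _ ⟨x, hx, rfl⟩
  obtain ⟨b, hb, hbω⟩ := Finset.mem_image.1 (hω n)
  refine ⟨_, hmaps n b hb ⟨x, hx, rfl⟩, ?_⟩
  simp only
  rw [Finset.sum_range_succ, ← hbω, add_assoc, ← map_add, cumProd, Matrix.mul_inv_rev, toMap_mul,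
    add_comm x]

lemma isCompact_cyl (ω : ℕ → E d) (n : ℕ) : IsCompact (cyl R t ω n) :=
  (isCompact_unitCube t).image (by fun_prop)

lemma exists_limit
    (hlim : Tendsto (fun n => ‖toMap (invProd R n)‖) atTop (𝓝 0))
    (hmaps : ∀ n, ∀ b ∈ B n,
      (fun x => toMap (realMat (R n))⁻¹ (x + intVec b)) '' unitCube t ⊆ unitCube t)
    {ω : ℕ → E d} (hω : ∀ n, ω n ∈ invImage (cumProd R (n + 1)) (B n)) :
    ∃ s, Tendsto (fun n => ∑ k ∈ Finset.range n, ω k) atTop (𝓝 s) ∧ ∀ n, s ∈ cyl R t ω n := by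
  have hanti : Antitone (cyl R t ω) := antitone_nat_of_succ_le (cyl_succ_subset hmaps hω)
  obtain ⟨M, hM⟩ := (isCompact_unitCube t).isBounded.exists_norm_le
  have hne : ∀ n, (cyl R t ω n).Nonempty := fun n => ⟨_, t, mem_unitCube_self t, rfl⟩
  obtain ⟨s, hs⟩ := IsCompact.nonempty_iInter_of_sequence_nonempty_isCompact_isClosed
    (cyl R t ω) (fun n => hanti (Nat.le_succ n)) hne (isCompact_cyl ω 0)
    fun n => (isCompact_cyl ω n).isClosed
  rw [Set.mem_iInter] at hs
  refine ⟨s, ?_, hs⟩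
  rw [tendsto_iff_norm_sub_tendsto_zero]
  have h0 : Tendsto (fun n => ‖toMap (invProd R n)‖ * M) atTop (𝓝 0) := by
    simpa using hlim.mul_const M
  refine squeeze_zero (fun _ => norm_nonneg _) (fun n => ?_) h0
  obtain ⟨x, hx, hxs⟩ := hs n
  rw [← hxs, invProd_eq]
  simp only [sub_add_cancel_left, norm_neg]
  exact ((toMap (cumProd R n)⁻¹).le_opNorm x).trans
    (mul_le_mul_of_nonneg_left (hM x hx) (norm_nonneg _))

/-- Existence of the infinite convolution, with its support and the mass of its first cylinders. -/
lemma exists_infiniteConvolution (hR : ∀ n, IsUnit (realMat (R n)).det)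
    (hB : ∀ n, (B n).Nonempty)
    (hlim : Tendsto (fun n => ‖toMap (invProd R n)‖) atTop (𝓝 0))
    (hmaps : ∀ n, ∀ b ∈ B n,
      (fun x => toMap (realMat (R n))⁻¹ (x + intVec b)) '' unitCube t ⊆ unitCube t) :
    ∃ μ : Measure (E d), IsInfiniteConvolution R B μ ∧
      (∀ ξ, Tendsto (fun n => prodMask R B n ξ) atTop (𝓝 (fhat μ ξ))) ∧
      (∀ᵐ x ∂μ, x ∈ unitCube t) ∧
      ∀ b ∈ B 0, ((B 0).card : ℝ)⁻¹ ≤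
        μ.real ((fun x => toMap (realMat (R 0))⁻¹ (x + intVec b)) '' unitCube t) := by
  classical
  set P : ℕ → Measure (E d) := fun n => discreteMeasure (invImage (cumProd R (n + 1)) (B n))
    with hP
  have hprob : ∀ n, IsProbabilityMeasure (P n) := fun n =>
    isProbabilityMeasure_discreteMeasure (invImage_nonempty _ (hB n))
  set Q : Measure (ℕ → E d) := Measure.infinitePi P with hQ
  have hmeas : ∀ n, Measurable fun ω : ℕ → E d => ∑ k ∈ Finset.range n, ω k := fun n => by
    fun_prop
  have hmap : ∀ n, Q.map (fun ω => ∑ k ∈ Finset.range n, ω k) = finiteConv R B n := by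
    intro n
    induction n with
    | zero => simp [finiteConv]
    | succ n ih =>
      have hind := (ProbabilityTheory.iIndepFun_infinitePi (P := P) (X := fun _ x => x)
        (fun _ => measurable_id)).indepFun_sum_range_succ (fun i => measurable_pi_apply i) n
      have h := hind.map_add_eq_map_conv_map (by
        have := hmeas n
        convert this using 1
        ext ω; simp) (measurable_pi_apply n)
      have e1 : (∑ j ∈ Finset.range n, fun ω : ℕ → E d => ω j) =
          fun ω => ∑ k ∈ Finset.range n, ω k := by ext ω; simp
      rw [e1, ih] at h
      have e2 : Measure.map (fun ω : ℕ → E d => ω n) Q = P n := Measure.infinitePi_map_eval P n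
      rw [e2] at h
      rw [finiteConv, ← h]
      congr 1
      ext ω; simp [Finset.sum_range_succ]
  have hae : ∀ᵐ ω ∂Q, ∀ n, ω n ∈ invImage (cumProd R (n + 1)) (B n) := by
    rw [ae_all_iff]
    intro n
    have h1 := discreteMeasure_ae_mem (invImage (cumProd R (n + 1)) (B n))
    have h2 : Measure.map (fun ω : ℕ → E d => ω n) Q = P n := Measure.infinitePi_map_eval P n
    change ∀ᵐ x ∂(P n), _ at h1
    rw [← h2] at h1
    exact ae_of_ae_map (measurable_pi_apply n).aemeasurable h1
  obtain ⟨S, hSm, hS⟩ := measurable_limit_of_tendsto_metrizable_ae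
    (μ := Q) (fun n => (hmeas n).aemeasurable)
    (hae.mono fun ω hω => (exists_limit hlim hmaps hω).imp fun s hs => hs.1)
  have hScyl : ∀ᵐ ω ∂Q, ∀ n, S ω ∈ cyl R t ω n := by
    filter_upwards [hae, hS] with ω h1 h2
    obtain ⟨s, hs, hs'⟩ := exists_limit hlim hmaps h1
    rwa [tendsto_nhds_unique h2 hs]
  have hμ : IsProbabilityMeasure (Q.map S) := Measure.isProbabilityMeasure_map hSm.aemeasurable
  have hint : ∀ {F : Type} [NormedAddCommGroup F] [NormedSpace ℝ F] (f : E d → F)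
      (_ : Continuous f) (C : ℝ) (_ : ∀ x, ‖f x‖ ≤ C),
      Tendsto (fun n => ∫ x, f x ∂(finiteConv R B n)) atTop (𝓝 (∫ x, f x ∂(Q.map S))) := by
    intro F _ _ f hf C hC
    simp_rw [← hmap]
    have e : ∀ n, ∫ x, f x ∂(Q.map fun ω => ∑ k ∈ Finset.range n, ω k) =
        ∫ ω, f (∑ k ∈ Finset.range n, ω k) ∂Q := fun n =>
      integral_map (hmeas n).aemeasurable hf.aestronglyMeasurable
    simp_rw [e]
    rw [integral_map hSm.aemeasurable hf.aestronglyMeasurable]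
    refine tendsto_integral_of_dominated_convergence (fun _ => C)
      (fun n => (hf.comp_stronglyMeasurable (hmeas n).stronglyMeasurable).aestronglyMeasurable)
      (integrable_const _) (fun n => Eventually.of_forall fun ω => hC _) ?_
    filter_upwards [hS] with ω hω
    exact (hf.tendsto _).comp hω
  refine ⟨Q.map S, ⟨hμ, fun f => hint f f.continuous ‖f‖ f.norm_coe_le_norm⟩, fun ξ => ?_, ?_, ?_⟩
  · have := hint (expo ξ) (continuous_expo ξ) 1 fun x => (norm_expo ξ x).le
    refine this.congr fun n => ?_
    exact fhat_finiteConv hR hB n ξ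
  · refine (ae_map_iff (p := fun x => x ∈ unitCube t) hSm.aemeasurable
      (isCompact_unitCube t).measurableSet).2 ?_
    filter_upwards [hScyl] with ω hω
    obtain ⟨x, hx, hxs⟩ := hω 0
    rw [← hxs]
    simpa [cumProd, toMap_one] using hx
  · intro b hb
    set K := (fun x => toMap (realMat (R 0))⁻¹ (x + intVec b)) '' unitCube t with hK
    have hKc : IsCompact K := (isCompact_unitCube t).image (by fun_prop)
    set a := toMap (cumProd R 1)⁻¹ (intVec b) with ha
    have haI : a ∈ invImage (cumProd R 1) (B 0) := Finset.mem_image.2 ⟨b, hb, rfl⟩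
    have h1 : Q {ω | ω 0 = a} = ((B 0).card : ENNReal)⁻¹ := by
      have h2 : Measure.map (fun ω : ℕ → E d => ω 0) Q = P 0 := Measure.infinitePi_map_eval P 0
      have h3 := discreteMeasure_singleton haI
      change P 0 {a} = _ at h3
      rw [← h2, Measure.map_apply (measurable_pi_apply 0) (measurableSet_singleton a),
        card_invImage (isUnit_det_cumProd hR 1)] at h3
      exact h3
    have h2 : Q {ω | ω 0 = a} ≤ (Q.map S) K := by
      rw [Measure.map_apply hSm hKc.measurableSet]
      refine measure_mono_ae ?_
      filter_upwards [hScyl] with ω hω hωa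
      obtain ⟨x, hx, hxs⟩ := hω 1
      change S ω ∈ K
      refine ⟨x, hx, ?_⟩
      change ω 0 = a at hωa
      rw [← hxs]
      simp only [Finset.sum_range_one]
      rw [hωa, ha, ← map_add, add_comm]
      simp [cumProd]
    rw [h1] at h2
    have h3 := ENNReal.toReal_mono (measure_ne_top _ _) h2
    simpa [Measure.real] using h3

end

section

lemma ae_eq_zero_of_integral_expo_eq_zero {μ : Measure (E d)} {g : E d → ℝ} (hg : Integrable g μ)
    (h : ∀ ξ, ∫ x, (g x : ℂ) * expo ξ x ∂μ = 0) : g =ᵐ[μ] 0 := by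
  have hfin : ∀ {f : E d → ℝ}, Integrable f μ →
      IsFiniteMeasure (μ.withDensity fun x => ENNReal.ofReal (f x)) := fun hf =>
    isFiniteMeasure_withDensity_ofReal hf.2
  have hp := hfin hg
  have hn := hfin hg.neg
  have hint : ∀ {f : E d → ℝ}, Integrable f μ → ∀ ξ : E d,
      fhat (μ.withDensity fun x => ENNReal.ofReal (f x)) ξ =
        ∫ x, ((max (f x) 0 : ℝ) : ℂ) * expo ξ x ∂μ := by
    intro f hf ξ
    rw [fhat, integral_withDensity_eq_integral_toReal_smul₀ hf.aemeasurable.ennreal_ofReal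
      (Eventually.of_forall fun x => ENNReal.ofReal_lt_top)]
    simp [ENNReal.toReal_ofReal', Complex.real_smul]
  have hbd : ∀ {f : E d → ℝ}, Integrable f μ → ∀ ξ : E d,
      Integrable (fun x => ((max (f x) 0 : ℝ) : ℂ) * expo ξ x) μ := by
    intro f hf ξ
    refine Integrable.mul_bdd (c := 1) hf.pos_part.ofReal (continuous_expo ξ).aestronglyMeasurable
      (Eventually.of_forall fun x => (norm_expo ξ x).le)
  have heq : (μ.withDensity fun x => ENNReal.ofReal (g x)) =
      μ.withDensity fun x => ENNReal.ofReal ((-g) x) := by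
    refine Measure.ext_of_charFun (funext fun t => ?_)
    have key : ∀ ξ : E d, fhat (μ.withDensity fun x => ENNReal.ofReal (g x)) ξ =
        fhat (μ.withDensity fun x => ENNReal.ofReal ((-g) x)) ξ := by
      intro ξ
      rw [hint hg, hint hg.neg, ← sub_eq_zero, ← integral_sub (hbd hg ξ) (hbd hg.neg ξ), ← h ξ]
      refine integral_congr_ae (Eventually.of_forall fun x => ?_)
      simp only [Pi.neg_apply]
      rw [← sub_mul, ← Complex.ofReal_sub]
      congr 2
      rcases le_total (g x) 0 with h0 | h0
      · rw [max_eq_right h0, max_eq_left (by linarith)]; ring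
      · rw [max_eq_left h0, max_eq_right (by linarith)]; ring
    have := key ((2 * Real.pi)⁻¹ • t)
    rwa [fhat_eq_charFun, fhat_eq_charFun, smul_smul,
      mul_inv_cancel₀ (by positivity), one_smul] at this
  have hne : ∫⁻ x, ENNReal.ofReal (g x) ∂μ ≠ ⊤ := by
    have := measure_ne_top (μ.withDensity fun x => ENNReal.ofReal (g x)) Set.univ
    rwa [withDensity_apply _ MeasurableSet.univ, Measure.restrict_univ] at this
  have hae := (withDensity_eq_iff hg.aemeasurable.ennreal_ofReal
    hg.neg.aemeasurable.ennreal_ofReal hne).1 heq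
  filter_upwards [hae] with x hx
  simp only [Pi.neg_apply] at hx
  simp only [Pi.zero_apply]
  rcases lt_trichotomy (g x) 0 with h0 | h0 | h0
  · rw [ENNReal.ofReal_of_nonpos h0.le] at hx
    have := ENNReal.ofReal_eq_zero.1 hx.symm
    linarith
  · exact h0
  · rw [ENNReal.ofReal_of_nonpos (p := -g x) (by linarith)] at hx
    have := ENNReal.ofReal_eq_zero.1 hx
    linarith

variable (μ : Measure (E d)) [IsProbabilityMeasure μ]

lemma memLp_expo (ξ : E d) : MemLp (expo ξ) 2 μ :=
  MemLp.of_bound (continuous_expo ξ).aestronglyMeasurable 1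
    (Eventually.of_forall fun x => (norm_expo ξ x).le)

/-- The exponential `x ↦ exp (2πi ξ·x)` as an element of `L²(μ)`. -/
def expoLp (ξ : E d) : Lp ℂ 2 μ := (memLp_expo μ ξ).toLp

lemma inner_expoLp (ξ : E d) (f : Lp ℂ 2 μ) :
    inner ℂ (expoLp μ ξ) f = ∫ x, f x * expo (-ξ) x ∂μ := by
  rw [L2.inner_def]
  refine integral_congr_ae ?_
  filter_upwards [(memLp_expo μ ξ).coeFn_toLp] with x hx
  rw [expoLp, hx, expo_neg_left, RCLike.inner_apply]

lemma inner_expoLp_expoLp (ξ η : E d) : inner ℂ (expoLp μ ξ) (expoLp μ η) = fhat μ (η - ξ) := by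
  rw [inner_expoLp, fhat]
  refine integral_congr_ae ?_
  filter_upwards [(memLp_expo μ η).coeFn_toLp] with x hx
  rw [expoLp, hx, sub_eq_add_neg, expo_add_left]

lemma norm_expoLp (ξ : E d) : ‖expoLp μ ξ‖ = 1 := by
  have h : ‖expoLp μ ξ‖ ^ 2 = 1 := by
    rw [← inner_self_eq_norm_sq (𝕜 := ℂ), inner_expoLp_expoLp, sub_self, fhat_zero]
    simp
  nlinarith [norm_nonneg (expoLp μ ξ)]

/-- The exponentials are total in `L²(μ)`. -/
lemma eq_zero_of_inner_expoLp (f : Lp ℂ 2 μ) (h : ∀ ξ, inner ℂ (expoLp μ ξ) f = 0) : f = 0 := by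
  have hf : Integrable f μ := (Lp.memLp f).integrable (by norm_num)
  have h1 : ∀ ξ, ∫ x, f x * expo ξ x ∂μ = 0 := fun ξ => by
    have := h (-ξ)
    rwa [inner_expoLp, neg_neg] at this
  have h2 : ∀ ξ, ∫ x, starRingEnd ℂ (f x) * expo ξ x ∂μ = 0 := fun ξ => by
    have := congrArg (starRingEnd ℂ) (h1 (-ξ))
    rw [← integral_conj, map_zero] at this
    rw [← this]
    simp [expo_neg_left]
  have hi : ∀ ξ, Integrable (fun x => f x * expo ξ x) μ := fun ξ =>
    hf.mul_bdd (c := 1) (continuous_expo ξ).aestronglyMeasurable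
      (Eventually.of_forall fun x => (norm_expo ξ x).le)
  have hi' : ∀ ξ, Integrable (fun x => starRingEnd ℂ (f x) * expo ξ x) μ := fun ξ =>
    (Complex.conjCLE.toContinuousLinearMap.integrable_comp hf).mul_bdd (c := 1)
      (continuous_expo ξ).aestronglyMeasurable
      (Eventually.of_forall fun x => (norm_expo ξ x).le)
  have hre : (fun x => (f x).re) =ᵐ[μ] 0 := by
    refine ae_eq_zero_of_integral_expo_eq_zero hf.re fun ξ => ?_
    have : ∀ x, ((f x).re : ℂ) * expo ξ x =
        (1 / 2 : ℂ) * (f x * expo ξ x + starRingEnd ℂ (f x) * expo ξ x) := by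
      intro x; rw [Complex.re_eq_add_conj]; ring
    simp_rw [this]
    rw [integral_const_mul, integral_add (hi ξ) (hi' ξ), h1, h2]; simp
  have him : (fun x => (f x).im) =ᵐ[μ] 0 := by
    refine ae_eq_zero_of_integral_expo_eq_zero hf.im fun ξ => ?_
    have : ∀ x, ((f x).im : ℂ) * expo ξ x =
        (1 / (2 * Complex.I) : ℂ) * (f x * expo ξ x - starRingEnd ℂ (f x) * expo ξ x) := by
      intro x; rw [Complex.im_eq_sub_conj]; ring
    simp_rw [this]
    rw [integral_const_mul, integral_sub (hi ξ) (hi' ξ), h1, h2]; simp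
  rw [Lp.eq_zero_iff_ae_eq_zero]
  filter_upwards [hre, him] with x hx hy
  exact Complex.ext hx hy

lemma orthonormal_expoLp {Λ : Set (E d)}
    (hΛ : ∀ l ∈ Λ, ∀ m ∈ Λ, l ≠ m → fhat μ (m - l) = 0) :
    Orthonormal ℂ fun l : Λ => expoLp μ l := by
  refine ⟨fun l => norm_expoLp μ l, fun l m hlm => ?_⟩
  simp only
  rw [inner_expoLp_expoLp]
  exact hΛ l l.2 m m.2 fun h => hlm (Subtype.ext h)

/-- Bessel's inequality for an orthonormal family of exponentials. -/
lemma summable_norm_fhat_sq {Λ : Set (E d)}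
    (hΛ : ∀ l ∈ Λ, ∀ m ∈ Λ, l ≠ m → fhat μ (m - l) = 0) (ξ : E d) :
    Summable fun l : Λ => ‖fhat μ (ξ + l)‖ ^ 2 := by
  have := (orthonormal_expoLp μ hΛ).inner_products_summable (expoLp μ (-ξ))
  refine this.congr fun l => ?_
  rw [← norm_inner_symm, inner_expoLp_expoLp, sub_neg_eq_add, add_comm]

lemma inner_eq_zero_of_hasSum {H ι : Type*} [NormedAddCommGroup H] [InnerProductSpace ℂ H]
    {v : ι → H} (hv : Orthonormal ℂ v) {u f : H}
    (hu : HasSum (fun i => ‖inner ℂ (v i) u‖ ^ 2) (‖u‖ ^ 2))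
    (hf : ∀ i, inner ℂ (v i) f = 0) : inner ℂ u f = 0 := by
  have hb : ∀ s : Finset ι,
      ‖inner ℂ u f‖ ^ 2 ≤ (‖u‖ ^ 2 - ∑ i ∈ s, ‖inner ℂ (v i) u‖ ^ 2) * ‖f‖ ^ 2 := by
    intro s
    set p := ∑ i ∈ s, inner ℂ (v i) u • v i with hp
    have h1 : inner ℂ u f = inner ℂ (u - p) f := by
      rw [inner_sub_left, hp, sum_inner]
      simp [inner_smul_left, hf]
    have h2 : ‖u - p‖ ^ 2 = ‖u‖ ^ 2 - ∑ i ∈ s, ‖inner ℂ (v i) u‖ ^ 2 := by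
      have hpp : inner ℂ p p = ∑ i ∈ s, ((‖inner ℂ (v i) u‖ ^ 2 : ℝ) : ℂ) := by
        rw [hp, hv.inner_sum]
        refine Finset.sum_congr rfl fun i _ => ?_
        rw [Complex.conj_mul']; push_cast; rfl
      have hup : inner ℂ u p = ∑ i ∈ s, ((‖inner ℂ (v i) u‖ ^ 2 : ℝ) : ℂ) := by
        rw [hp, inner_sum]
        refine Finset.sum_congr rfl fun i _ => ?_
        rw [inner_smul_right, ← inner_conj_symm u (v i), Complex.mul_conj']; push_cast; rfl
      rw [@norm_sub_sq ℂ, ← inner_self_eq_norm_sq (𝕜 := ℂ) p, hpp, hup, ← Complex.ofReal_sum]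
      simp only [Complex.ofReal_re, RCLike.re_eq_complex_re]
      ring
    rw [h1, ← h2, ← mul_pow]
    exact pow_le_pow_left₀ (norm_nonneg _) (norm_inner_le_norm _ _) 2
  have ht : Tendsto (fun s : Finset ι =>
      (‖u‖ ^ 2 - ∑ i ∈ s, ‖inner ℂ (v i) u‖ ^ 2) * ‖f‖ ^ 2) atTop (𝓝 0) := by
    have := (tendsto_const_nhds (x := ‖u‖ ^ 2)).sub hu
    simpa using this.mul_const (‖f‖ ^ 2)
  have := ge_of_tendsto' ht hb
  have h0 : ‖inner ℂ u f‖ = 0 := by nlinarith [norm_nonneg (inner ℂ u f)]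
  simpa using h0

/-- The Jorgensen–Pedersen criterion. -/
lemma isSpectrum_of_tsum_eq_one {Λ : Set (E d)} (hc : Λ.Countable)
    (hΛ : ∀ l ∈ Λ, ∀ m ∈ Λ, l ≠ m → fhat μ (m - l) = 0)
    (hsum : ∀ ξ, ∑' l : Λ, ‖fhat μ (ξ + l)‖ ^ 2 = 1) : IsSpectrum μ Λ := by
  have hv := orthonormal_expoLp μ hΛ
  have hbot : (Submodule.span ℂ (Set.range fun l : Λ => expoLp μ l))ᗮ = ⊥ := by
    rw [Submodule.eq_bot_iff]
    intro f hf
    have hf' : ∀ l : Λ, inner ℂ (expoLp μ l) f = 0 := fun l =>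
      (Submodule.mem_orthogonal _ f).1 hf _ (Submodule.subset_span ⟨l, rfl⟩)
    refine eq_zero_of_inner_expoLp μ f fun ξ => inner_eq_zero_of_hasSum hv ?_ hf'
    rw [norm_expoLp, one_pow, ← hsum (-ξ)]
    convert (summable_norm_fhat_sq μ hΛ (-ξ)).hasSum using 3 with l
    rw [← norm_inner_symm, inner_expoLp_expoLp, neg_add_eq_sub]
  refine ⟨hc, HilbertBasis.mkOfOrthogonalEqBot hv hbot, fun l => ?_⟩
  rw [HilbertBasis.coe_mkOfOrthogonalEqBot]
  exact (memLp_expo μ l).coeFn_toLp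

end

variable {R : ℕ → Matrix (Fin d) (Fin d) ℤ} {B : ℕ → Finset (Fin d → ℤ)}

lemma tendsto_invProd_shift (hR : ∀ n, IsUnit (realMat (R n)).det)
    (hlim : Tendsto (fun n => ‖toMap (invProd R n)‖) atTop (𝓝 0)) (n : ℕ) :
    Tendsto (fun m => ‖toMap (invProd (fun k => R (n + k)) m)‖) atTop (𝓝 0) := by
  have h1 : ∀ m, toMap (invProd (fun k => R (n + k)) m) =
      (toMap (cumProd R n)).comp (toMap (invProd R (m + n))) := by
    intro m
    ext1 x
    rw [ContinuousLinearMap.comp_apply, ← toMap_mul, invProd_eq, invProd_eq, add_comm m,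
      cumProd_shift, Matrix.mul_inv_rev, ← Matrix.mul_assoc,
      Matrix.mul_nonsing_inv _ (isUnit_det_cumProd hR n), Matrix.one_mul]
  have h2 : Tendsto (fun m => ‖toMap (cumProd R n)‖ * ‖toMap (invProd R (m + n))‖) atTop
      (𝓝 0) := by
    simpa using ((tendsto_add_atTop_iff_nat n).2 hlim).const_mul ‖toMap (cumProd R n)‖
  refine squeeze_zero (fun _ => norm_nonneg _) (fun m => ?_) h2
  rw [h1]
  exact ContinuousLinearMap.opNorm_comp_le _ _

lemma fhat_eq_prodMask_mul {μ ν : Measure (E d)} {n : ℕ}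
    (hμ : ∀ ξ, Tendsto (fun m => prodMask R B m ξ) atTop (𝓝 (fhat μ ξ)))
    (hν : ∀ ξ, Tendsto (fun m => prodMask (fun k => R (n + k)) (fun k => B (n + k)) m ξ) atTop
      (𝓝 (fhat ν ξ))) (ξ : E d) :
    fhat μ ξ = prodMask R B n ξ * fhat ν (dualMap R n ξ) := by
  have h1 := (tendsto_add_atTop_iff_nat n).2 (hμ ξ)
  have h2 := (hν (dualMap R n ξ)).const_mul (prodMask R B n ξ)
  refine tendsto_nhds_unique h1 (h2.congr fun m => ?_)
  rw [add_comm m, prodMask_add]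

/-- One step of the construction of the spectrum. -/
lemma UnitSum.exists_next (hadm : ∀ n, IsAdmissiblePair (R n) (B n))
    (hlim : Tendsto (fun n => ‖toMap (invProd R n)‖) atTop (𝓝 0)) (ν : ℕ → Measure (E d))
    {ε δ δ₀ : ℝ} {s : Set ℕ} (hs : s.Infinite) (hδ₀ : 0 < δ₀)
    (hzero : ∀ n, ∀ y : E d, ‖y‖ < δ₀ → ε ≤ ‖fhat (ν n) y‖) (hδ : δ ≤ δ₀ / 2)
    (hpos : ∀ n ∈ s, ∀ x : E d, ∃ k ∈ latt d, ∀ y : E d, ‖y‖ < δ →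
      ε ≤ ‖fhat (ν n) (x + k + y)‖)
    {n : ℕ} {Λ : Finset (E d)} (h : UnitSum R B n Λ) :
    ∃ n' > n, ∃ Λ' : Finset (E d), Λ ⊆ Λ' ∧ UnitSum R B n' Λ' ∧
      ∀ l ∈ Λ', ∀ y : E d, ‖y‖ < δ → ε ≤ ‖fhat (ν n') (dualMap R n' l + y)‖ := by
  classical
  have hR : ∀ n, IsUnit (realMat (R n)).det := fun n => (hadm n).expanding.isUnit_det
  have hev : ∀ᶠ n' in atTop, ∀ l ∈ Λ, ‖dualMap R n' l‖ < δ₀ / 2 := by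
    rw [Filter.eventually_all_finset]
    intro l _
    have := (tendsto_dualMap hlim l).norm
    rw [norm_zero] at this
    exact this.eventually (gt_mem_nhds (half_pos hδ₀))
  obtain ⟨n', hn's, hn'Λ, hn'⟩ := ((Nat.frequently_atTop_iff_infinite.2 hs).and_eventually
    (hev.and (eventually_gt_atTop n))).exists
  obtain ⟨Λ₁, hΛ₁, hΛ₁'⟩ := h.exists_of_le hadm hn'.le
  choose k hk hky using hpos n' hn's
  obtain ⟨Λ₂, hΛ₂, hmem⟩ := hΛ₁'.translate hadm
    (fun l => if l ∈ Λ then 0 else k (dualMap R n' l)) (fun l => by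
      split_ifs
      · exact (latt d).zero_mem
      · exact hk _)
  refine ⟨n', hn', Λ₂, fun l hl => (hmem l).2 ⟨l, hΛ₁ hl, by simp [hl]⟩, hΛ₂, fun l hl y hy => ?_⟩
  obtain ⟨m, -, rfl⟩ := (hmem l).1 hl
  rw [map_add, dualMap_transpose hR]
  split_ifs with hm
  · refine hzero n' _ ((norm_add_le _ _).trans_lt ?_)
    rw [add_zero]
    have := hn'Λ m hm
    linarith
  · exact hky _ y hy

/-- The union of an increasing sequence of spectra of the finite convolutions, along which the
tails have Fourier transforms bounded below, is a spectrum of the infinite convolution. -/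
lemma isSpectrum_iUnion (hB : ∀ n, (B n).Nonempty)
    (hlim : Tendsto (fun n => ‖toMap (invProd R n)‖) atTop (𝓝 0))
    {μ : Measure (E d)} [IsProbabilityMeasure μ] {ν : ℕ → Measure (E d)}
    (hμ : ∀ ξ, Tendsto (fun m => prodMask R B m ξ) atTop (𝓝 (fhat μ ξ)))
    (hfac : ∀ n ξ, fhat μ ξ = prodMask R B n ξ * fhat (ν n) (dualMap R n ξ))
    {ε δ : ℝ} (hε : 0 < ε) (hδ : 0 < δ) {N : ℕ → ℕ} (hN : StrictMono N) {Λ : ℕ → Finset (E d)}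
    (hmono : Monotone Λ) (hunit : ∀ j, UnitSum R B (N j) (Λ j))
    (hpos : ∀ j, ∀ l ∈ Λ j, ∀ y : E d, ‖y‖ < δ →
      ε ≤ ‖fhat (ν (N j)) (dualMap R (N j) l + y)‖) :
    IsSpectrum μ (⋃ j, (Λ j : Set (E d))) := by
  classical
  set S : Set (E d) := ⋃ j, (Λ j : Set (E d)) with hS
  have horth : ∀ l ∈ S, ∀ m ∈ S, l ≠ m → fhat μ (m - l) = 0 := by
    intro l hl m hm hlm
    obtain ⟨i, hi⟩ := Set.mem_iUnion.1 hl
    obtain ⟨j, hj⟩ := Set.mem_iUnion.1 hm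
    rw [hfac (N (max i j)), (hunit (max i j)).prodMask_eq_zero hB
      (hmono (le_max_left i j) hi) (hmono (le_max_right i j) hj) hlm, zero_mul]
  refine isSpectrum_of_tsum_eq_one μ (Set.countable_iUnion fun j => (Λ j).countable_toSet) horth
    fun ξ => ?_
  set f : ℕ → S → ℝ := fun j l =>
    if (l : E d) ∈ Λ j then ‖prodMask R B (N j) (ξ + l)‖ ^ 2 else 0 with hf
  have hsum : ∀ j, ∑' l, f j l = 1 := by
    intro j
    rw [← (hunit j).2 ξ, hf]
    rw [tsum_subtype S (fun l => if l ∈ Λ j then ‖prodMask R B (N j) (ξ + l)‖ ^ 2 else 0),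
      tsum_eq_sum (s := Λ j)]
    · refine Finset.sum_congr rfl fun l hl => ?_
      rw [Set.indicator_of_mem (Set.mem_iUnion.2 ⟨j, hl⟩), if_pos hl]
    · intro l hl
      simp [hl]
  have hlimf : Tendsto (fun j => ∑' l, f j l) atTop (𝓝 (∑' l : S, ‖fhat μ (ξ + l)‖ ^ 2)) := by
    refine tendsto_tsum_of_dominated_convergence
      (bound := fun l : S => (ε ^ 2)⁻¹ * ‖fhat μ (ξ + l)‖ ^ 2)
      ((summable_norm_fhat_sq μ horth ξ).mul_left _) (fun l => ?_) ?_
    · obtain ⟨i, hi⟩ := Set.mem_iUnion.1 l.2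
      refine ((((hμ (ξ + l)).comp hN.tendsto_atTop).norm).pow 2).congr' ?_
      filter_upwards [eventually_ge_atTop i] with j hj
      simp only [hf]
      rw [if_pos (hmono hj hi)]
      rfl
    · have hev : ∀ᶠ j in atTop, ‖dualMap R (N j) ξ‖ < δ := by
        have := ((tendsto_dualMap hlim ξ).comp hN.tendsto_atTop).norm
        rw [norm_zero] at this
        exact this.eventually (gt_mem_nhds hδ)
      filter_upwards [hev] with j hj l
      simp only [hf]
      split_ifs with hl
      · have h1 := hpos j l hl _ hj
        rw [← map_add, add_comm (l : E d)] at h1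
        rw [hfac (N j), norm_mul, mul_pow, Real.norm_of_nonneg (by positivity),
          ← div_eq_inv_mul, le_div_iff₀ (by positivity)]
        gcongr
      · rw [norm_zero]; positivity
  simp_rw [hsum] at hlimf
  exact tendsto_nhds_unique hlimf tendsto_const_nhds

end SpectralConv
end

open SpectralConv
theorem theorem1p4 (d : ℕ) (R : ℕ → Matrix (Fin d) (Fin d) ℤ) (B : ℕ → Finset (Fin d → ℤ))
    (hadm : ∀ n, IsAdmissiblePair (R n) (B n))
    (hlim : Tendsto (fun n => ‖toMap (invProd R n)‖) atTop (𝓝 0))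
    (t₀ : E d)
    (hmaps : ∀ n, ∀ b ∈ B n,
      (fun x => toMap (realMat (R n))⁻¹ (x + intVec b)) '' unitCube t₀ ⊆ unitCube t₀)
    (hint : ∃ (R' : Matrix (Fin d) (Fin d) ℤ) (B' : Finset (Fin d → ℤ)),
      IsAdmissiblePair R' B' ∧ {n | R n = R' ∧ B n = B'}.Infinite ∧
      ∃ b₀ ∈ B', (fun x => toMap (realMat R')⁻¹ (x + intVec b₀)) '' unitCube t₀ ⊆
        interior (unitCube t₀)) :
    ∃ μ : Measure (E d), IsInfiniteConvolution R B μ ∧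
      ∃ Λ : Set (E d), Λ ⊆ Set.range (intVec : (Fin d → ℤ) → E d) ∧ IsSpectrum μ Λ := by
  have hR : ∀ n, IsUnit (realMat (R n)).det := fun n => (hadm n).expanding.isUnit_det
  have hB : ∀ n, (B n).Nonempty := fun n => (hadm n).nonempty
  obtain ⟨R', B', hadm', hinf, b₀, hb₀, hb₀int⟩ := hint
  obtain ⟨μ, hμ, hμF, -, -⟩ := exists_infiniteConvolution hR hB hlim hmaps
  have hμp := hμ.1
  choose ν hν hνF hνC hνm using fun n =>
    exists_infiniteConvolution (R := fun k => R (n + k)) (B := fun k => B (n + k))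
      (fun k => hR (n + k)) (fun k => hB (n + k)) (tendsto_invProd_shift hR hlim n)
      (fun k => hmaps (n + k))
  have hfac : ∀ n ξ, fhat μ ξ = prodMask R B n ξ * fhat (ν n) (dualMap R n ξ) := fun n =>
    fhat_eq_prodMask_mul hμF (hνF n)
  obtain ⟨ε₁, hε₁, δ₁, hδ₁, hpos⟩ := exists_equiPositive t₀
    ((isCompact_unitCube t₀).image (by fun_prop)) hb₀int
    (c := (B'.card : ℝ)⁻¹) (inv_pos.2 (by exact_mod_cast hadm'.nonempty.card_pos))
  obtain ⟨δ₀, hδ₀, hzero⟩ := exists_half_le_norm_fhat t₀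
  set ε := min ε₁ (1 / 2) with hε
  set δ := min δ₁ (δ₀ / 2) with hδ
  have hε0 : 0 < ε := lt_min hε₁ (by norm_num)
  have hδ0 : 0 < δ := lt_min hδ₁ (half_pos hδ₀)
  have hstep : ∀ p : {p : ℕ × Finset (E d) // UnitSum R B p.1 p.2},
      ∃ q : {p : ℕ × Finset (E d) // UnitSum R B p.1 p.2}, p.1.1 < q.1.1 ∧ p.1.2 ⊆ q.1.2 ∧
        ∀ l ∈ q.1.2, ∀ y : E d, ‖y‖ < δ →
          ε ≤ ‖fhat (ν q.1.1) (dualMap R q.1.1 l + y)‖ := by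
    intro p
    obtain ⟨n', hn', Λ', h1, h2, h3⟩ := p.2.exists_next hadm hlim ν hinf hδ₀
      (fun n y hy => (min_le_right _ _).trans (hzero (ν n) (hν n).1 (hνC n) y hy))
      (min_le_right δ₁ _) (ε := ε) (fun n hn x => by
        obtain ⟨h1, h2⟩ := hn
        have hm : (B'.card : ℝ)⁻¹ ≤ (ν n).real
            ((fun x => toMap (realMat R')⁻¹ (x + intVec b₀)) '' unitCube t₀) := by
          have := hνm n b₀ (by simpa [h2] using hb₀)
          simpa only [add_zero, h1, h2] using this
        obtain ⟨k, hk, hky⟩ := hpos (ν n) (hν n).1 (hνC n) hm x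
        exact ⟨k, hk, fun y hy =>
          (min_le_left _ _).trans (hky y (hy.trans_le (min_le_left _ _)))⟩)
    exact ⟨⟨(n', Λ'), h2⟩, hn', h1, h3⟩
  choose next hlt hsub hgood using hstep
  set u : ℕ → {p : ℕ × Finset (E d) // UnitSum R B p.1 p.2} := fun j =>
    next^[j + 1] ⟨(0, {0}), unitSum_zero⟩ with hu
  have husucc : ∀ j, u (j + 1) = next (u j) := fun j => Function.iterate_succ_apply' _ _ _
  refine ⟨μ, hμ, ⋃ j, ((u j).1.2 : Set (E d)), Set.iUnion_subset fun j => (u j).2.1,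
    isSpectrum_iUnion (N := fun j => (u j).1.1) hB hlim hμF hfac hε0 hδ0
      (strictMono_nat_of_lt_succ fun j => ?_)
      (monotone_nat_of_le_succ fun j => ?_) (fun j => (u j).2) (fun j => ?_)⟩
  · rw [husucc]; exact hlt _
  · rw [husucc]; exact hsub _
  · have : u j = next (next^[j] ⟨(0, {0}), unitSum_zero⟩) := Function.iterate_succ_apply' _ _ _
    rw [this]
    exact hgood _
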